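/- All posets are finite. $P+Q$ denotes the direct sum (disjoint union without relations between the summands) and $P|_A$ the induced poset on $A$. A homomorphism of posets is an order-preserving map, and $\mathcal H(P,R)$ is the set of homomorphisms $P\to R$. **Construction.** Let $P=(X,\le_P)$ and $Q=(Y,\le_Q)$ be disjoint finite posets, $A\subseteq X$ convex in $P$, $B\subseteq Y$ convex in $Q$, and $\beta:P|_A\to Q|_B$ an isomorphism. Put $W=X\setminus A$, and let $T$ be the poset on $W\cup Y$ in which $v\le_T v'$ iff one of the following holds: $v,v'\in W$ and $v\le_P v'$; $v,v'\in Y$ and $v\le_Q v'$; $v\in Y$, $v'\in W$ and there is $a\in A$ with $a\le_P v'$ and $v\le_Q\beta(a)$; $v\in W$, $v'\in Y$ and there is $a\in A$ with $v\le_P a$ and $\beta(a)\le_Q v'$. Let $\psi:P\to T$ be given by $\psi(x)=x$ for $x\in X\setminus A$ and $\psi(x)=\beta(x)$ for $x\in A$. **EV-systems.** The EV-system $\mathcal E(R)$ of a poset $R$ is the set of triples $\mathfrak a=(\mathfrak a_1,\mathfrak a_2,\mathfrak a_3)$ with $\mathfrak a_1\in R$, $\mathfrak a_2\subseteq\{y: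 y<\mathfrak a_1\}$, $\mathfrak a_3\subseteq\{y: \mathfrak a_1<y\}$, with the relation $\mathfrak a\le_+\mathfrak b$ iff $\mathfrak a=\mathfrak b$, or $\mathfrak a_1\in\mathfrak b_2$ and $\mathfrak b_1\in\mathfrak a_3$. A homomorphism of EV-systems is a map preserving $\le_+$. **Schemes.** For a map $\xi$ on a finite poset $E$ and $x\in E$, let $G_\xi(x)$ be the connectivity component of $x$ in $\xi^{-1}(\xi(x))$: the points reachable from $x$ by a finite sequence of points of $\xi^{-1}(\xi(x))$ in which consecutive points are comparable. For $\xi\in\mathcal H(E,R)$ put $$\alpha_\xi(x)=\bigl(\xi(x),\ \{\xi(y): y<z\text{ for some }z\in G_\xi(x)\}\setminus\{\xi(x)\},\ \{\xi(y): z<y\text{ for some }z\in G_\xi(x)\}\setminus\{\xi(x)\}\bigr)\in\mathcal E(R).$$ A Hom-scheme $\rho$ from $R$ to $S$ assigns to every finite poset $E$ a map $\rho_E:\mathcal H(E,R)\to\mathcal H(E,S)$. It is *strong* if every $\rho_E$ is one-to-one. It is a *G-scheme* if $G_{\rho_E(\xi)}(x)=G_\xi(x)$ for all $E$, $\xi\in\mathcal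 H(E,R)$, $x\in E$. It is an *I-scheme* if it is a G-scheme and $\alpha_\xi(x)=\alpha_\zeta(y)$ implies $\rho_E(\xi)(x)=\rho_{E'}(\zeta)(y)$ for all finite posets $E,E'$, all $\xi\in\mathcal H(E,R)$, $\zeta\in\mathcal H(E',R)$, $x\in E$, $y\in E'$. **Statement.** Suppose in addition that $A$ is an antichain in $P$, so that $\mathcal E(P|_A)=\{(a,\emptyset,\emptyset):a\in A\}$. Note that $\mathcal E(P+Q)=\mathcal E(P)+\mathcal E(Q)$ and $\mathcal E(P|_A+T)=\mathcal E(P|_A)+\mathcal E(T)$. Define $\epsilon:\mathcal E(P+Q)\to\mathcal E(P|_A+T)$ by $$\epsilon(\mathfrak a)=\begin{cases}\mathfrak a,&\mathfrak a\in\mathcal E(Q)\cup\mathcal E(P|_A),\\(\psi(\mathfrak a_1),\psi(\mathfrak a_2),\psi(\mathfrak a_3)),&\mathfrak a\in\mathcal E(P)\setminus\mathcal E(P|_A).\end{cases}$$ Then $\epsilon$ is a one-to-one homomorphism of EV-systems, and there is a strong I-scheme $\rho$ from $P+Q$ to $P|_A+T$ obtained from $\epsilon$: for every finite poset $E$, every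 $\xi\in\mathcal H(E,P+Q)$ and every $x\in E$, $$\rho_E(\xi)(x)=\epsilon(\alpha_\xi(x))_1\qquad\text{and}\qquad\alpha_{\rho_E(\xi)}(x)=\epsilon(\alpha_\xi(x)).$$ -/

import Mathlib

universe v u w

namespace PosetScheme

/-! ### Zigzag connectivity and the sets `G_ξ(x)` -/

/-- `γ_A(x)`, the points of `A` that a zigzag line inside `A` connects with the point `x` of `A`. -/
def gamma {P : Type*} [PartialOrder P] (A : Set P) (x : P) : Set P :=
  {y | Relation.ReflTransGen (fun u v => u ∈ A ∧ v ∈ A ∧ (u < v ∨ v < u)) x y}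

/-- `G_ξ(x)`: the connectivity component of `x` in the pre-image of `ξ(x)`. -/
def G {P Z : Type*} [PartialOrder P] (ξ : P → Z) (x : P) : Set P :=
  gamma (ξ ⁻¹' {ξ x}) x

/-! ### EV-systems -/

/-- The EV-system of a poset `P`: triples `(x, D, U)` where all points of `D` are strictly below
`x` and all points of `U` are strictly above `x`. -/
@[ext]
structure EV (P : Type*) [PartialOrder P] where
  pt : P
  down : Set P
  up : Set P
  down_subset : down ⊆ Set.Iio pt
  up_subset : up ⊆ Set.Ioi pt

/-- The relation `<₊` on an EV-system. -/
def EV.ltPlus {P : Type*} [PartialOrder P] (a b : EV P) : Prop :=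
  a.pt ∈ b.down ∧ b.pt ∈ a.up

/-- The relation `≤₊` on an EV-system. -/
def EV.lePlus {P : Type*} [PartialOrder P] (a b : EV P) : Prop :=
  EV.ltPlus a b ∨ a = b

/-- A map between EV-systems is a homomorphism if it preserves `≤₊`. -/
def EV.IsHom {R S : Type*} [PartialOrder R] [PartialOrder S] (e : EV R → EV S) : Prop :=
  ∀ a b : EV R, EV.lePlus a b → EV.lePlus (e a) (e b)

/-- A strictly monotone map acts on triples by `(x, D, U) ↦ (f x, f(D), f(U))`. -/
def EV.map {R S : Type*} [PartialOrder R] [PartialOrder S] (f : R → S) (hf : StrictMono f)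
    (a : EV R) : EV S where
  pt := f a.pt
  down := f '' a.down
  up := f '' a.up
  down_subset := by
    rintro _ ⟨y, hy, rfl⟩
    exact hf (a.down_subset hy)
  up_subset := by
    rintro _ ⟨y, hy, rfl⟩
    exact hf (a.up_subset hy)

theorem map_eq_of_mem_G {P Z : Type*} [PartialOrder P] (ξ : P → Z) {x z : P}
    (h : z ∈ G ξ x) : ξ z = ξ x := by
  induction h with
  | refl => rfl
  | tail _ h _ => exact h.2.1

/-- The map `α_ξ : P → EV R` of a homomorphism `ξ : P → R`. Its value at `x` consists of `ξ(x)`,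
and of the values other than `ξ(x)` which `ξ` takes strictly below, respectively strictly above,
the points of `G_ξ(x)`. For strict `ξ` one has `G_ξ(x) = {x}`, and the value is
`(ξ(x), ξ(Iio x), ξ(Ioi x))`. -/
def alpha {P R : Type*} [PartialOrder P] [PartialOrder R] (ξ : P →o R) (x : P) : EV R where
  pt := ξ x
  down := (ξ '' {y | ∃ z ∈ G ξ x, y < z}) \ {ξ x}
  up := (ξ '' {y | ∃ z ∈ G ξ x, z < y}) \ {ξ x}
  down_subset := by
    rintro _ ⟨⟨y, ⟨z, hz, hyz⟩, rfl⟩, hne⟩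
    exact lt_of_le_of_ne ((ξ.monotone hyz.le).trans_eq (map_eq_of_mem_G ξ hz)) hne
  up_subset := by
    rintro _ ⟨⟨y, ⟨z, hz, hzy⟩, rfl⟩, hne⟩
    exact lt_of_le_of_ne ((map_eq_of_mem_G ξ hz).symm.trans_le (ξ.monotone hzy.le)) (Ne.symm hne)

/-! ### Hom-schemes -/

/-- A Hom-scheme from `R` to `S`: a map `H(P, R) → H(P, S)` for every finite poset `P`. -/
def HomScheme (R : Type u) (S : Type w) [PartialOrder R] [PartialOrder S] :
    Type (max (v + 1) u w) :=
  ∀ (P : Type v) [PartialOrder P] [Finite P], (P →o R) → (P →o S)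

namespace HomScheme


variable {R : Type u} {S : Type w} [PartialOrder R] [PartialOrder S]

/-- A Hom-scheme is strong if all its maps are one-to-one. -/
def IsStrong (ρ : HomScheme.{v} R S) : Prop :=
  ∀ (P : Type v) [PartialOrder P] [Finite P], Function.Injective (ρ P)

/-- A G-scheme preserves all the sets `G_ξ(x)`. -/
def IsGScheme (ρ : HomScheme.{v} R S) : Prop :=
  ∀ (P : Type v) [PartialOrder P] [Finite P] (ξ : P →o R) (x : P), G (ρ P ξ) x = G ξ x

/-- An I-scheme is an image-controlled G-scheme: the value of `ρ_P(ξ)` at `x` depends on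
`α_ξ(x)` only. -/
def IsIScheme (ρ : HomScheme.{v} R S) : Prop :=
  ρ.IsGScheme ∧
    ∀ (P P' : Type v) [PartialOrder P] [Finite P] [PartialOrder P'] [Finite P']
      (ξ : P →o R) (ζ : P' →o R) (x : P) (y : P'),
      alpha ξ x = alpha ζ y → ρ P ξ x = ρ P' ζ y

end HomScheme

/-! ### The poset `T` -/

section Glue

variable {X Y : Type*} [PartialOrder X] [PartialOrder Y] {A : Set X} {B : Set Y}

/-- The carrier of the poset `T`, the disjoint union of `W = X \ A` and `Y`. -/
inductive Glue (β : A ≃o B)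
  | ofO (w : ↥Aᶜ) : Glue β
  | ofQ (y : Y) : Glue β

/-- The relation `≤_T`; the four cases are `≤_O`, `≤_Q`, `≤_d` and `≤_u`. -/
def Glue.le (β : A ≃o B) : Glue β → Glue β → Prop
  | .ofO w, .ofO w' => (w : X) ≤ w'
  | .ofQ y, .ofQ y' => y ≤ y'
  | .ofQ y, .ofO w => ∃ a : A, (a : X) ≤ w ∧ y ≤ β a
  | .ofO w, .ofQ y => ∃ a : A, (w : X) ≤ a ∧ (β a : Y) ≤ y

theorem Glue.not_between [hA : A.OrdConnected] {a b : A} {w : ↥Aᶜ}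
    (h₁ : (a : X) ≤ w) (h₂ : (w : X) ≤ b) : False :=
  w.2 (hA.out a.2 b.2 ⟨h₁, h₂⟩)

/-- The poset `T = (V, ≤_T)`. -/
instance Glue.instPartialOrder [A.OrdConnected] (β : A ≃o B) : PartialOrder (Glue β) where
  le := Glue.le β
  le_refl v := by
    cases v <;> exact le_rfl
  le_trans v w z h₁ h₂ := by
    rcases v with v | v <;> rcases w with w | w <;> rcases z with z | z <;>
      simp only [Glue.le] at h₁ h₂ ⊢
    · exact h₁.trans h₂
    · obtain ⟨a, ha, h⟩ := h₂
      exact ⟨a, h₁.trans ha, h⟩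
    · obtain ⟨a, ha, h⟩ := h₁
      obtain ⟨b, hb, h'⟩ := h₂
      have hab : a ≤ b := β.le_iff_le.1 (show (β a : Y) ≤ β b from h.trans h')
      exact ha.trans (le_trans (show (a : X) ≤ b from hab) hb)
    · obtain ⟨a, ha, h⟩ := h₁
      exact ⟨a, ha, h.trans h₂⟩
    · obtain ⟨a, ha, h⟩ := h₁
      exact ⟨a, ha.trans h₂, h⟩
    · obtain ⟨a, ha, h⟩ := h₁
      obtain ⟨b, hb, h'⟩ := h₂
      have hab : β a ≤ β b := β.le_iff_le.2 (show (a : X) ≤ b from ha.trans hb)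
      exact h.trans (le_trans (show (β a : Y) ≤ β b from hab) h')
    · obtain ⟨a, ha, h⟩ := h₂
      exact ⟨a, ha, h₁.trans h⟩
    · exact h₁.trans h₂
  le_antisymm v w h₁ h₂ := by
    rcases v with v | v <;> rcases w with w | w <;> simp only [Glue.le] at h₁ h₂
    · exact congrArg _ (Subtype.ext (le_antisymm h₁ h₂))
    · obtain ⟨a, ha, -⟩ := h₁
      obtain ⟨b, hb, -⟩ := h₂
      exact (Glue.not_between hb ha).elim
    · obtain ⟨a, ha, -⟩ := h₁
      obtain ⟨b, hb, -⟩ := h₂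
      exact (Glue.not_between ha hb).elim
    · exact congrArg _ (le_antisymm h₁ h₂)

open Classical in
/-- The embedding `ψ` of `P` into `T`: a point outside `A` goes to itself, and a point `x` of `A`
goes to `β(x)`. -/
noncomputable def psi (β : A ≃o B) (x : X) : Glue β :=
  if h : x ∈ A then .ofQ (β ⟨x, h⟩) else .ofO ⟨x, h⟩

theorem psi_strictMono [A.OrdConnected] (β : A ≃o B) : StrictMono (psi β) := by
  intro x y hxy
  have key : Glue.le β (psi β x) (psi β y) ∧ psi β x ≠ psi β y := by
    by_cases hx : x ∈ A <;> by_cases hy : y ∈ A <;> simp only [psi, hx, hy, dite_true, dite_false]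
    · have h : β ⟨x, hx⟩ < β ⟨y, hy⟩ := β.lt_iff_lt.2 hxy
      have h' : (β ⟨x, hx⟩ : Y) < β ⟨y, hy⟩ := h
      exact ⟨h'.le, fun e => h'.ne (Glue.ofQ.inj e)⟩
    · exact ⟨⟨⟨x, hx⟩, hxy.le, le_rfl⟩, fun e => nomatch e⟩
    · exact ⟨⟨⟨y, hy⟩, hxy.le, le_rfl⟩, fun e => nomatch e⟩
    · exact ⟨hxy.le, fun e => hxy.ne (congrArg Subtype.val (Glue.ofO.inj e))⟩
  exact lt_of_le_of_ne key.1 key.2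

/-- The map `P + Q → P|_A + T` which is `ψ` on `P` and the identity on `Q`; its values lie
in `T`. -/
noncomputable def phi (β : A ≃o B) : X ⊕ Y → A ⊕ Glue β
  | .inl x => .inr (psi β x)
  | .inr y => .inr (.ofQ y)

theorem phi_strictMono [A.OrdConnected] (β : A ≃o B) : StrictMono (phi β) := by
  rintro (x | x) (y | y) h
  · exact Sum.inr_lt_inr_iff.2 (psi_strictMono β (Sum.inl_lt_inl_iff.1 h))
  · exact (Sum.not_inl_lt_inr h).elim
  · exact (Sum.not_inr_lt_inl h).elim
  · have h' := Sum.inr_lt_inr_iff.1 h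
    refine Sum.inr_lt_inr_iff.2 (lt_of_le_of_ne (show Glue.le β (.ofQ x) (.ofQ y) from h'.le) ?_)
    exact fun e => h'.ne (Glue.ofQ.inj e)

open Classical in
/-- The map `ε` from the EV-system of `P + Q` to the EV-system of `P|_A + T`, for an antichain `A`,
where the EV-system of `P|_A` consists of the triples `(a, ∅, ∅)` with `a ∈ A`. These triples are
left fixed. All others are mapped by `(x, D, U) ↦ (ψ(x), ψ(D), ψ(U))` if they belong to the
EV-system of `P`, and they are left fixed if they belong to the EV-system of `Q`. -/
noncomputable def epsilon [A.OrdConnected] (β : A ≃o B) (c : EV (X ⊕ Y)) : EV (A ⊕ Glue β) :=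
  if h : ∃ a : A, c.pt = Sum.inl (a : X) ∧ c.down = ∅ ∧ c.up = ∅ then
    { pt := Sum.inl h.choose
      down := ∅
      up := ∅
      down_subset := Set.empty_subset _
      up_subset := Set.empty_subset _ }
  else
    EV.map (phi β) (phi_strictMono β) c

end Glue

end PosetScheme

open PosetScheme

namespace PosetScheme

/-! The map `phi` is strict and identifies only `a` in `A` with `β a`. `epsilon` acts on second and
third components through `phi`, and leaves `phi` in the first component only at isolated triples
`(a, ∅, ∅)`. These take part in no relation `<₊`, so `epsilon` preserves `≤₊` (`epsilon_carriedBy`).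
If `x < y`, then `α_ξ(x)` and `α_ξ(y)` coincide when `ξ x = ξ y` and are related by `<₊` otherwise.
Hence `x ↦ ε(α_ξ(x))₁` is order-preserving and identifies the same comparable pairs as `ξ`. It
therefore has the same components, and its `α` is `ε ∘ α_ξ` (`EV.CarriedBy.alpha_hom`). Injectivity
of `epsilon` then makes the scheme strong. It rests on the antichain: a non-isolated triple over `a
∈ A` contains a point of `X \ A`, and its image in `W` rules out an origin in `Q`. -/

theorem G_eq_of_lt {P Z : Type*} [PartialOrder P] (ξ : P → Z) {x y : P} (h : x < y ∨ y < x)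
    (hxy : ξ x = ξ y) : G ξ x = G ξ y := by
  have hfib : ξ ⁻¹' {ξ x} = ξ ⁻¹' {ξ y} := by rw [hxy]
  unfold G
  rw [hfib]
  ext z
  constructor
  · exact fun hz => Relation.ReflTransGen.head ⟨rfl, hxy, h.symm⟩ hz
  · exact fun hz => Relation.ReflTransGen.head ⟨hxy, rfl, h⟩ hz

theorem G_eq_of_mem {P Z : Type*} [PartialOrder P] (ξ : P → Z) {x z : P} (h : z ∈ G ξ x) :
    G ξ z = G ξ x := by
  induction h with
  | refl => rfl
  | tail _ h ih => exact (G_eq_of_lt ξ h.2.2.symm (h.2.1.trans h.1.symm)).trans ih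

theorem mem_G_of_lt {P Z : Type*} [PartialOrder P] (ξ : P → Z) {x y z : P} (hz : z ∈ G ξ x)
    (h : z < y ∨ y < z) (hy : ξ y = ξ x) : y ∈ G ξ x :=
  Relation.ReflTransGen.tail hz ⟨map_eq_of_mem_G ξ hz, hy, h⟩

/-- If two maps identify the same comparable pairs, then they have the same components. -/
theorem G_congr {P Z Z' : Type*} [PartialOrder P] (ξ : P → Z) (η : P → Z')
    (h : ∀ x y, x < y → (ξ x = ξ y ↔ η x = η y)) (x : P) : G ξ x = G η x := by
  have h' : ∀ {u v}, (u < v ∨ v < u) → (ξ u = ξ v ↔ η u = η v) := by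
    rintro u v (huv | huv)
    · exact h u v huv
    · rw [eq_comm, h v u huv, eq_comm]
  ext z
  constructor
  · intro hz
    induction hz with
    | refl => exact Relation.ReflTransGen.refl
    | tail _ hs ih =>
      exact mem_G_of_lt η ih hs.2.2
        (((h' hs.2.2).1 (hs.1.trans hs.2.1.symm)).symm.trans (map_eq_of_mem_G η ih))
  · intro hz
    induction hz with
    | refl => exact Relation.ReflTransGen.refl
    | tail _ hs ih =>
      exact mem_G_of_lt ξ ih hs.2.2
        (((h' hs.2.2).2 (hs.1.trans hs.2.1.symm)).symm.trans (map_eq_of_mem_G ξ ih))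

theorem alpha_eq_of_mem_G {P R : Type*} [PartialOrder P] [PartialOrder R] (ξ : P →o R) {x z : P}
    (h : z ∈ G ξ x) : alpha ξ z = alpha ξ x := by
  have hG := G_eq_of_mem ξ h
  have hv := map_eq_of_mem_G ξ h
  ext1 <;> simp only [alpha, hG, hv]

theorem alpha_eq_of_lt {P R : Type*} [PartialOrder P] [PartialOrder R] (ξ : P →o R) {x y : P}
    (h : x < y) (hxy : ξ x = ξ y) : alpha ξ x = alpha ξ y :=
  alpha_eq_of_mem_G ξ (mem_G_of_lt ξ Relation.ReflTransGen.refl (Or.inr h) hxy)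

/-- Each of the two points witnesses membership for the other, since a point lies in its own
component. This turns the order of `P` into the relation that EV-homomorphisms preserve. -/
theorem alpha_ltPlus {P R : Type*} [PartialOrder P] [PartialOrder R] (ξ : P →o R) {x y : P}
    (h : x < y) (hxy : ξ x ≠ ξ y) : EV.ltPlus (alpha ξ x) (alpha ξ y) :=
  ⟨⟨⟨x, ⟨y, Relation.ReflTransGen.refl, h⟩, rfl⟩, hxy⟩,
    ⟨⟨y, ⟨x, Relation.ReflTransGen.refl, h⟩, rfl⟩, hxy.symm⟩⟩

/-! ### Homomorphisms induced by a map of EV-systems -/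

section Induced

variable {R S : Type*} [PartialOrder R] [PartialOrder S]

/-- A map `e` of EV-systems is carried by `f : R → S` if it acts on the second and third components
by taking images under `f`, and also on the first components of triples related by `<₊`. -/
structure EV.CarriedBy (e : EV R → EV S) (f : R → S) : Prop where
  down : ∀ c, (e c).down = f '' c.down
  up : ∀ c, (e c).up = f '' c.up
  pt_left : ∀ a b, EV.ltPlus a b → (e a).pt = f a.pt
  pt_right : ∀ a b, EV.ltPlus a b → (e b).pt = f b.pt

variable {e : EV R → EV S} {f : R → S}

theorem EV.CarriedBy.ltPlus (he : EV.CarriedBy e f) {a b : EV R} (h : EV.ltPlus a b) :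
    EV.ltPlus (e a) (e b) := by
  constructor
  · rw [he.down, he.pt_left a b h]
    exact ⟨_, h.1, rfl⟩
  · rw [he.up, he.pt_right a b h]
    exact ⟨_, h.2, rfl⟩

theorem EV.CarriedBy.isHom (he : EV.CarriedBy e f) : EV.IsHom e := by
  rintro a b (h | rfl)
  · exact Or.inl (he.ltPlus h)
  · exact Or.inr rfl

theorem EV.CarriedBy.pt_lt (he : EV.CarriedBy e f) {P : Type*} [PartialOrder P] (ξ : P →o R)
    {x y : P} (h : x < y) (hxy : ξ x ≠ ξ y) : (e (alpha ξ x)).pt < (e (alpha ξ y)).pt :=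
  (e (alpha ξ y)).down_subset (he.ltPlus (alpha_ltPlus ξ h hxy)).1

/-- The homomorphism `x ↦ e(α_ξ(x))₁`. -/
def EV.CarriedBy.hom (he : EV.CarriedBy e f) {P : Type*} [PartialOrder P] (ξ : P →o R) :
    P →o S where
  toFun x := (e (alpha ξ x)).pt
  monotone' := by
    intro x y hxy
    rcases hxy.eq_or_lt with rfl | hlt
    · exact le_rfl
    · by_cases h : ξ x = ξ y
      · exact (congrArg (fun c => (e c).pt) (alpha_eq_of_lt ξ hlt h)).le
      · exact (he.pt_lt ξ hlt h).le

theorem EV.CarriedBy.hom_eq_iff (he : EV.CarriedBy e f) {P : Type*} [PartialOrder P] (ξ : P →o R)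
    {x y : P} (hlt : x < y) : he.hom ξ x = he.hom ξ y ↔ ξ x = ξ y := by
  refine ⟨fun h => ?_, fun h => congrArg (fun c => (e c).pt) (alpha_eq_of_lt ξ hlt h)⟩
  by_contra hne
  exact (he.pt_lt ξ hlt hne).ne h

theorem EV.CarriedBy.G_hom (he : EV.CarriedBy e f) {P : Type*} [PartialOrder P] (ξ : P →o R)
    (x : P) : G (he.hom ξ) x = G ξ x :=
  G_congr _ _ (fun _ _ h => he.hom_eq_iff ξ h) x

/-- A point `y` that contributes to `alpha ξ x` is comparable to some `z` in the component with `ξ y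
≠ ξ z`. So it sits in a `<₊` pair, where the induced map agrees with `f ∘ ξ`. -/
theorem EV.CarriedBy.alpha_hom (he : EV.CarriedBy e f) {P : Type*} [PartialOrder P] (ξ : P →o R)
    (x : P) : alpha (he.hom ξ) x = e (alpha ξ x) := by
  ext1
  · rfl
  · rw [he.down]
    have key : ∀ y z, z ∈ G ξ x → y < z → ξ y ≠ ξ x →
        he.hom ξ y = f (ξ y) ∧ he.hom ξ y ≠ he.hom ξ x := by
      intro y z hz hyz hne
      have hne' : ξ y ≠ ξ z := fun h => hne (h.trans (map_eq_of_mem_G ξ hz))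
      refine ⟨he.pt_left _ _ (alpha_ltPlus ξ hyz hne'), fun h => ?_⟩
      -- `hom_eq_iff` needs a comparable pair, so `x` is replaced by `z`, which lies in the same
      -- component.
      rw [← map_eq_of_mem_G (he.hom ξ) (x := x) (z := z) ((he.G_hom ξ x).symm ▸ hz)] at h
      exact hne' ((he.hom_eq_iff ξ hyz).1 h)
    ext s
    constructor
    · rintro ⟨⟨y, ⟨z, hz, hyz⟩, rfl⟩, hs⟩
      rw [he.G_hom] at hz
      -- Otherwise `y` would join the component of `x`, on which the induced map is constant.
      have hne : ξ y ≠ ξ x := fun h => hs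
        (map_eq_of_mem_G (he.hom ξ) ((he.G_hom ξ x).symm ▸ mem_G_of_lt ξ hz (Or.inr hyz) h))
      exact ⟨ξ y, ⟨⟨y, ⟨z, hz, hyz⟩, rfl⟩, hne⟩, (key y z hz hyz hne).1.symm⟩
    · rintro ⟨_, ⟨⟨y, ⟨z, hz, hyz⟩, rfl⟩, hne⟩, rfl⟩
      obtain ⟨h₁, h₂⟩ := key y z hz hyz hne
      exact ⟨⟨y, ⟨z, (he.G_hom ξ x).symm ▸ hz, hyz⟩, h₁⟩, h₁ ▸ h₂⟩
  · rw [he.up]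
    have key : ∀ y z, z ∈ G ξ x → z < y → ξ y ≠ ξ x →
        he.hom ξ y = f (ξ y) ∧ he.hom ξ y ≠ he.hom ξ x := by
      intro y z hz hzy hne
      have hne' : ξ z ≠ ξ y := fun h => hne (h.symm.trans (map_eq_of_mem_G ξ hz))
      refine ⟨he.pt_right _ _ (alpha_ltPlus ξ hzy hne'), fun h => ?_⟩
      rw [← map_eq_of_mem_G (he.hom ξ) (x := x) (z := z) ((he.G_hom ξ x).symm ▸ hz)] at h
      exact hne' ((he.hom_eq_iff ξ hzy).1 h.symm)
    ext s
    constructor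
    · rintro ⟨⟨y, ⟨z, hz, hzy⟩, rfl⟩, hs⟩
      rw [he.G_hom] at hz
      have hne : ξ y ≠ ξ x := fun h => hs
        (map_eq_of_mem_G (he.hom ξ) ((he.G_hom ξ x).symm ▸ mem_G_of_lt ξ hz (Or.inl hzy) h))
      exact ⟨ξ y, ⟨⟨y, ⟨z, hz, hzy⟩, rfl⟩, hne⟩, (key y z hz hzy hne).1.symm⟩
    · rintro ⟨_, ⟨⟨y, ⟨z, hz, hzy⟩, rfl⟩, hne⟩, rfl⟩
      obtain ⟨h₁, h₂⟩ := key y z hz hzy hne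
      exact ⟨⟨y, ⟨z, (he.G_hom ξ x).symm ▸ hz, hzy⟩, h₁⟩, h₁ ▸ h₂⟩

end Induced

/-! ### The map `epsilon`: compatibility with `phi` and injectivity -/

section Epsilon

variable {X Y : Type*} [PartialOrder X] [PartialOrder Y] {A : Set X} {B : Set Y}

theorem psi_of_notMem (β : A ≃o B) {x : X} (h : x ∉ A) : psi β x = .ofO ⟨x, h⟩ := by
  simp [psi, h]

theorem psi_injective (β : A ≃o B) : Function.Injective (psi β) := by
  intro x y h
  by_cases hx : x ∈ A <;> by_cases hy : y ∈ A <;> simp [psi, hx, hy] at h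
  · exact congrArg Subtype.val (β.injective (Subtype.ext h))
  · exact h


/-- The triple `c` belongs to the EV-system of the antichain `A`. -/
def EV.InAntichain (A : Set X) (c : EV (X ⊕ Y)) : Prop :=
  ∃ a : A, c.pt = Sum.inl (a : X) ∧ c.down = ∅ ∧ c.up = ∅

theorem phi_ne_inl (β : A ≃o B) (s : X ⊕ Y) (a : A) : phi β s ≠ .inl a := by
  rcases s with x | y <;> simp [phi]

/-- A triple over a point of the antichain `A` which does not belong to the EV-system of `A`
contains a point outside `A`. -/
theorem EV.exists_notMem_of_not_inAntichain (hA : IsAntichain (· ≤ ·) A) {c : EV (X ⊕ Y)}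
    (h : ¬ c.InAntichain A) {a : X} (ha : a ∈ A) (hc : c.pt = .inl a) :
    ∃ p : X, p ∉ A ∧ (.inl p : X ⊕ Y) ∈ c.down ∪ c.up := by
  have hne : (c.down ∪ c.up).Nonempty := by
    rw [Set.nonempty_iff_ne_empty]
    intro h0
    rw [Set.union_empty_iff] at h0
    exact h ⟨⟨a, ha⟩, hc, h0⟩
  obtain ⟨s, hs⟩ := hne
  have hlt : s < .inl a ∨ .inl a < s := by
    rw [← hc]
    exact hs.imp (fun h => c.down_subset h) (fun h => c.up_subset h)
  rcases s with p | y
  · refine ⟨p, fun hp => ?_, hs⟩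
    rw [Sum.inl_lt_inl_iff, Sum.inl_lt_inl_iff] at hlt
    rcases hlt with hlt | hlt
    · exact hA hp ha hlt.ne hlt.le
    · exact hA ha hp hlt.ne hlt.le
  · rcases hlt with hlt | hlt
    · exact (Sum.not_inr_lt_inl hlt).elim
    · exact (Sum.not_inl_lt_inr hlt).elim

theorem EV.mem_inl_of_pt_inl {c : EV (X ⊕ Y)} {x : X} (hc : c.pt = .inl x) {s : X ⊕ Y}
    (hs : s ∈ c.down ∪ c.up) : ∃ p : X, s = .inl p := by
  rcases s with p | y
  · exact ⟨p, rfl⟩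
  · rcases hs with h | h
    · have := c.down_subset h
      rw [hc] at this
      exact (Sum.not_inr_lt_inl this).elim
    · have := c.up_subset h
      rw [hc] at this
      exact (Sum.not_inl_lt_inr this).elim

theorem EV.mem_inr_of_pt_inr {c : EV (X ⊕ Y)} {y : Y} (hc : c.pt = .inr y) {s : X ⊕ Y}
    (hs : s ∈ c.down ∪ c.up) : ∃ q : Y, s = .inr q := by
  rcases s with p | q
  · rcases hs with h | h
    · have := c.down_subset h
      rw [hc] at this
      exact (Sum.not_inl_lt_inr this).elim
    · have := c.up_subset h
      rw [hc] at this
      exact (Sum.not_inr_lt_inl this).elim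
  · exact ⟨q, rfl⟩

variable [A.OrdConnected]

theorem epsilon_of_inAntichain (β : A ≃o B) {c : EV (X ⊕ Y)} (h : c.InAntichain A) :
    ∃ a : A, c.pt = .inl (a : X) ∧ c.down = ∅ ∧ c.up = ∅ ∧ (epsilon β c).pt = .inl a ∧
      (epsilon β c).down = ∅ ∧ (epsilon β c).up = ∅ := by
  have h' : ∃ a : A, c.pt = Sum.inl (a : X) ∧ c.down = ∅ ∧ c.up = ∅ := h
  obtain ⟨h₁, h₂, h₃⟩ := h'.choose_spec
  refine ⟨h'.choose, h₁, h₂, h₃, ?_⟩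
  simp only [epsilon, dif_pos h', and_self]

theorem epsilon_of_not_inAntichain (β : A ≃o B) {c : EV (X ⊕ Y)} (h : ¬ c.InAntichain A) :
    epsilon β c = EV.map (phi β) (phi_strictMono β) c :=
  dif_neg h

theorem epsilon_carriedBy (β : A ≃o B) : EV.CarriedBy (epsilon β) (phi β) where
  down c := by
    by_cases h : c.InAntichain A
    · obtain ⟨a, -, h₂, -, -, h₅, -⟩ := epsilon_of_inAntichain β h
      rw [h₅, h₂, Set.image_empty]
    · rw [epsilon_of_not_inAntichain β h]
      rfl
  up c := by
    by_cases h : c.InAntichain A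
    · obtain ⟨a, -, -, h₃, -, -, h₆⟩ := epsilon_of_inAntichain β h
      rw [h₆, h₃, Set.image_empty]
    · rw [epsilon_of_not_inAntichain β h]
      rfl
  pt_left a b h := by
    have ha : ¬ a.InAntichain A := by
      rintro ⟨_, -, -, h₃⟩
      exact Set.notMem_empty _ (h₃ ▸ h.2)
    rw [epsilon_of_not_inAntichain β ha]
    rfl
  pt_right a b h := by
    have hb : ¬ b.InAntichain A := by
      rintro ⟨_, -, h₂, -⟩
      exact Set.notMem_empty _ (h₂ ▸ h.1)
    rw [epsilon_of_not_inAntichain β hb]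
    rfl

/-- Outside the EV-system of `A`, triples over `P` and triples over `Q` have different images. -/
theorem EV.map_phi_ne (β : A ≃o B) (hA : IsAntichain (· ≤ ·) A) {c d : EV (X ⊕ Y)}
    (h : ¬ c.InAntichain A) {x : X} {y : Y} (hc : c.pt = .inl x) (hd : d.pt = .inr y) :
    EV.map (phi β) (phi_strictMono β) c ≠ EV.map (phi β) (phi_strictMono β) d := by
  intro heq
  have hpt : phi β c.pt = phi β d.pt := congrArg EV.pt heq
  -- The union is used because the point outside `A` may lie on either side.
  have himg : phi β '' (c.down ∪ c.up) = phi β '' (d.down ∪ d.up) := by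
    rw [Set.image_union, Set.image_union]
    exact congrArg₂ (· ∪ ·) (congrArg EV.down heq) (congrArg EV.up heq)
  by_cases hx : x ∈ A
  · obtain ⟨p, hp, hmem⟩ := EV.exists_notMem_of_not_inAntichain hA h hx hc
    have hm : phi β (.inl p) ∈ phi β '' (d.down ∪ d.up) := himg ▸ ⟨_, hmem, rfl⟩
    obtain ⟨s, hs, hse⟩ := hm
    obtain ⟨q, rfl⟩ := EV.mem_inr_of_pt_inr hd hs
    simp [phi, psi_of_notMem β hp] at hse
  · rw [hc, hd] at hpt
    simp [phi, psi_of_notMem β hx] at hpt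

/-- Comparable points share a summand, so each triple lives in a single one. There `phi` is
one-to-one, and `EV.map_phi_ne` excludes the mixed case. -/
theorem EV.map_phi_injOn (β : A ≃o B) (hA : IsAntichain (· ≤ ·) A) {c d : EV (X ⊕ Y)}
    (hc : ¬ c.InAntichain A) (hd : ¬ d.InAntichain A)
    (h : EV.map (phi β) (phi_strictMono β) c = EV.map (phi β) (phi_strictMono β) d) : c = d := by
  have hpt : phi β c.pt = phi β d.pt := congrArg EV.pt h
  have hdn : phi β '' c.down = phi β '' d.down := congrArg EV.down h
  have hup : phi β '' c.up = phi β '' d.up := congrArg EV.up h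
  have hinl : Function.Injective (fun x : X => phi β (.inl x)) := fun x y hxy =>
    psi_injective β (Sum.inr.inj hxy)
  have hinr : Function.Injective (fun y : Y => phi β (.inr y)) := fun x y hxy =>
    Glue.ofQ.inj (Sum.inr.inj hxy)
  -- `phi` is one-to-one on each of the two summands
  have finish : ∀ t : Set (X ⊕ Y), Set.InjOn (phi β) t → c.pt ∈ t → d.pt ∈ t →
      c.down ∪ c.up ⊆ t → d.down ∪ d.up ⊆ t → c = d := by
    intro t ht h₁ h₂ h₃ h₄
    rw [Set.union_subset_iff] at h₃ h₄
    exact EV.ext (ht h₁ h₂ hpt) ((ht.image_eq_image_iff h₃.1 h₄.1).1 hdn)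
      ((ht.image_eq_image_iff h₃.2 h₄.2).1 hup)
  rcases hcp : c.pt with x | x <;> rcases hdp : d.pt with y | y
  · refine finish (Set.range .inl) ?_ ⟨x, hcp.symm⟩ ⟨y, hdp.symm⟩ ?_ ?_
    · rintro _ ⟨p, rfl⟩ _ ⟨q, rfl⟩ hpq
      exact congrArg _ (hinl hpq)
    · intro s hs
      obtain ⟨p, rfl⟩ := EV.mem_inl_of_pt_inl hcp hs
      exact ⟨p, rfl⟩
    · intro s hs
      obtain ⟨p, rfl⟩ := EV.mem_inl_of_pt_inl hdp hs
      exact ⟨p, rfl⟩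
  · exact (EV.map_phi_ne β hA hc hcp hdp h).elim
  · exact (EV.map_phi_ne β hA hd hdp hcp h.symm).elim
  · refine finish (Set.range .inr) ?_ ⟨x, hcp.symm⟩ ⟨y, hdp.symm⟩ ?_ ?_
    · rintro _ ⟨p, rfl⟩ _ ⟨q, rfl⟩ hpq
      exact congrArg _ (hinr hpq)
    · intro s hs
      obtain ⟨p, rfl⟩ := EV.mem_inr_of_pt_inr hcp hs
      exact ⟨p, rfl⟩
    · intro s hs
      obtain ⟨p, rfl⟩ := EV.mem_inr_of_pt_inr hdp hs
      exact ⟨p, rfl⟩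

/-- The first component of the image tells the two cases of `epsilon` apart: it lies in the summand
`A` for isolated triples and in `T` for all others. -/
theorem epsilon_injective (β : A ≃o B) (hA : IsAntichain (· ≤ ·) A) :
    Function.Injective (epsilon (Y := Y) β) := by
  intro c d h
  by_cases hc : c.InAntichain A <;> by_cases hd : d.InAntichain A
  · obtain ⟨a, hcp, hcd, hcu, hea, -, -⟩ := epsilon_of_inAntichain β hc
    obtain ⟨b, hdp, hdd, hdu, heb, -, -⟩ := epsilon_of_inAntichain β hd
    have hab : a = b := Sum.inl.inj (hea.symm.trans ((congrArg EV.pt h).trans heb))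
    exact EV.ext (by rw [hcp, hdp, hab]) (by rw [hcd, hdd]) (by rw [hcu, hdu])
  · obtain ⟨a, -, -, -, hea, -, -⟩ := epsilon_of_inAntichain β hc
    rw [h, epsilon_of_not_inAntichain β hd] at hea
    exact (phi_ne_inl β _ a hea).elim
  · obtain ⟨b, -, -, -, heb, -, -⟩ := epsilon_of_inAntichain β hd
    rw [← h, epsilon_of_not_inAntichain β hc] at heb
    exact (phi_ne_inl β _ b heb).elim
  · rw [epsilon_of_not_inAntichain β hc, epsilon_of_not_inAntichain β hd] at h
    exact EV.map_phi_injOn β hA hc hd h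

end Epsilon

end PosetScheme

theorem mainTheorem6 {X : Type u} {Y : Type w} [PartialOrder X] [PartialOrder Y]
    [Finite X] [Finite Y] (A : Set X) (B : Set Y) [A.OrdConnected] [B.OrdConnected]
    (β : A ≃o B) (hA : IsAntichain (· ≤ ·) A) :
    Function.Injective (epsilon β) ∧
    EV.IsHom (epsilon β) ∧
    ∃ ρ : HomScheme.{v} (X ⊕ Y) (A ⊕ Glue β),
      ρ.IsStrong ∧ ρ.IsIScheme ∧
      ∀ (P : Type v) [PartialOrder P] [Finite P] (ξ : P →o X ⊕ Y) (x : P),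
        ρ P ξ x = (epsilon β (alpha ξ x)).pt ∧
        alpha (ρ P ξ) x = epsilon β (alpha ξ x) := by
  have he := epsilon_carriedBy β
  refine ⟨epsilon_injective β hA, he.isHom, fun P _ _ ξ => he.hom ξ, ?_, ⟨?_, ?_⟩, ?_⟩
  · intro P _ _ ξ ζ h
    ext1
    funext x
    -- Both sides are the `alpha` of the common image at `x`, so injectivity of `epsilon` recovers
    -- `alpha ξ x` and with it `ξ x`.
    have h' : epsilon β (alpha ξ x) = epsilon β (alpha ζ x) := by
      rw [← he.alpha_hom ξ x, ← he.alpha_hom ζ x]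
      exact congrArg (fun η => alpha η x) h
    exact congrArg EV.pt (epsilon_injective β hA h')
  · exact fun P _ _ ξ x => he.G_hom ξ x
  · exact fun P P' _ _ _ _ ξ ζ x y h => congrArg (fun c => (epsilon β c).pt) h
  · exact fun P _ _ ξ x => ⟨rfl, he.alpha_hom ξ x⟩
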